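/- Let $L\ge 2$ and consider the toric code on the $L\times L$ square lattice with periodic boundaries: checks are the vertices, qubits are the edges, and $\mathbf H$ is the vertex--edge incidence matrix over $\mathbb F_2$. Let all qubits have the same a priori value $\gamma>0$. Syndrome-based min-sum (MS) decoding with flooding schedule, for an input vector $\mathbf s\in\mathbb F_2^{V}$, is the following: the qubit-to-check messages are initialised by $m^{(0)}_{q\to c}=\gamma$, and for $i\ge 1$ $$m^{(i)}_{c\to q}=(-1)^{\mathbf s(c)}\prod_{q'\in\mathcal N(c)\setminus q}\operatorname{sgn}\bigl(m^{(i-1)}_{q'\to c}\bigr)\min_{q'\in\mathcal N(c)\setminus q}\bigl|m^{(i-1)}_{q'\to c}\bigr|,\qquad m^{(i)}_{q\to c}=\gamma+\sum_{c'\in\mathcal N(q)\setminus c}m^{(i)}_{c'\to q}.$$ The a posteriori values are $\mathrm{app}_{\mathbf s}(q,0)=\gamma$ and $\mathrm{app}_{\mathbf s}(q,i)=\gamma+\sum_{c\in\mathcal N(q)}m^{(i)}_{c\to q}$ for $i\ge1$. An error estimate at iteration $i$ is any $\mathbf e$ with $\mathbf e(q)=0$ if $\mathrm{app}_{\mathbf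 s}(q,i)>0$ and $\mathbf e(q)=1$ if $\mathrm{app}_{\mathbf s}(q,i)<0$ (ties broken arbitrarily). MS decodes $\mathbf s$ if at some iteration some error estimate $\mathbf e$ satisfies $\mathbf H\mathbf e=\mathbf s$. Let $\mathbf s\neq 0$ be such that any two distinct unsatisfied checks (checks $c$ with $\mathbf s(c)=1$) are at lattice graph distance at least $5$. Then, for every unsatisfied check $c$ and every iteration $i\ge 0$: 1. MS decoding of $\mathbf s$ is locally blind in the neighbourhood of $c$: $\mathrm{app}_{\mathbf s}(q,i)=\mathrm{app}_{\mathbf s^c}(q,i)$ for each qubit $q$ incident to $c$, where $\mathbf s^c$ is the vector whose only unsatisfied check is $c$; 2. the two horizontal qubits incident to $c$ have the same a posteriori value, and so have the two vertical qubits incident to $c$; 3. every error estimate $\mathbf e$ at iteration $i$ violates the parity at $c$: $(\mathbf H\mathbf e)(c)\neq\mathbf s(c)$. Consequently, MS never decodes $\mathbf s$, at any iteration. -/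

import Mathlib

open Finset Matrix

noncomputable section

namespace MinSum

/-! ### Syndrome-based min-sum decoding (flooding schedule) of a binary parity-check matrix -/

section Decoder

variable {C Q : Type*} [Fintype C] [Fintype Q] [DecidableEq C] [DecidableEq Q]

/-- The qubits participating in the check `c`: its neighbours in the Tanner graph of `H`. -/
def checkNbrs (H : Matrix C Q (ZMod 2)) (c : C) : Finset Q :=
  univ.filter fun q => H c q = 1

/-- The checks in which the qubit `q` participates: its neighbours in the Tanner graph of `H`. -/
def qubitNbrs (H : Matrix C Q (ZMod 2)) (q : Q) : Finset C :=
  univ.filter fun c => H c q = 1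

/-- The minimum of `f` over a nonempty finite set (and `0` for the empty set, which never occurs
when every check involves at least two qubits). -/
def minOver (S : Finset Q) (f : Q → ℝ) : ℝ :=
  if h : S.Nonempty then S.inf' h f else 0

/-- The message sent by the check `c` to the qubit `q`, given the incoming qubit-to-check messages
`m q' c`:
`(-1)^(s c) * (∏ sign (m q' c)) * min |m q' c|`, with `q'` ranging over the neighbours of `c`
other than `q`. -/
def checkMsg (H : Matrix C Q (ZMod 2)) (s : C → ZMod 2) (m : Q → C → ℝ) (c : C) (q : Q) : ℝ :=
  (if s c = 1 then -1 else 1) *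
    (∏ q' ∈ (checkNbrs H c).erase q, Real.sign (m q' c)) *
    minOver ((checkNbrs H c).erase q) fun q' => |m q' c|

/-- The message sent by the qubit `q` to the check `c` after `i` iterations of min-sum with
a priori values `γ` and input syndrome `s`. -/
def qubitMsg (H : Matrix C Q (ZMod 2)) (γ : Q → ℝ) (s : C → ZMod 2) : ℕ → Q → C → ℝ
  | 0, q, _ => γ q
  | i + 1, q, c =>
      γ q + ∑ c' ∈ (qubitNbrs H q).erase c, checkMsg H s (qubitMsg H γ s i) c' q

/-- The a posteriori value of the qubit `q` computed by min-sum at iteration `i`. -/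
def app (H : Matrix C Q (ZMod 2)) (γ : Q → ℝ) (s : C → ZMod 2) : ℕ → Q → ℝ
  | 0, q => γ q
  | i + 1, q => γ q + ∑ c ∈ qubitNbrs H q, checkMsg H s (qubitMsg H γ s i) c q

/-- `e` is an error estimate compatible with the a posteriori values `a`: a qubit with positive
value is estimated error-free, one with negative value in error, and ties may be broken
in any way. -/
def IsEstimate (a : Q → ℝ) (e : Q → ZMod 2) : Prop :=
  ∀ q, (0 < a q → e q = 0) ∧ (a q < 0 → e q = 1)

/-- Min-sum decodes `s`: at some iteration, for some way of breaking ties, the error estimate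
satisfies the syndrome `s`. -/
def Decodes (H : Matrix C Q (ZMod 2)) (γ : Q → ℝ) (s : C → ZMod 2) : Prop :=
  ∃ (i : ℕ) (e : Q → ZMod 2), IsEstimate (app H γ s i) e ∧ H *ᵥ e = s

/-- Min-sum decoding of `s` is locally blind in the neighbourhood of the check `c`: at every
iteration the qubits neighbouring `c` have the same a posteriori values as when the decoder is run
on the fake syndrome whose only unsatisfied check is `c`. -/
def LocallyBlind (H : Matrix C Q (ZMod 2)) (γ : Q → ℝ) (s : C → ZMod 2) (c : C) : Prop :=
  ∀ q ∈ checkNbrs H c, ∀ i : ℕ, app H γ s i q = app H γ (Pi.single c 1) i q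

end Decoder

/-! ### The toric code on the `L × L` square lattice with periodic boundaries -/

/-- The checks: the vertices of the `L × L` periodic square lattice. -/
abbrev ToricCheck (L : ℕ) : Type := ZMod L × ZMod L

/-- The qubits: the edges of the lattice. `Sum.inl v` is the horizontal edge from `v` to
`v + (1, 0)`, and `Sum.inr v` is the vertical edge from `v` to `v + (0, 1)`. -/
abbrev ToricQubit (L : ℕ) : Type := ToricCheck L ⊕ ToricCheck L

/-- The two end vertices of an edge. -/
def toricEnds (L : ℕ) : ToricQubit L → Finset (ToricCheck L)
  | Sum.inl v => {v, v + (1, 0)}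
  | Sum.inr v => {v, v + (0, 1)}

/-- The parity-check matrix (vertex checks) of the toric code. -/
def toricH (L : ℕ) : Matrix (ToricCheck L) (ToricQubit L) (ZMod 2) :=
  Matrix.of fun c q => if c ∈ toricEnds L q then 1 else 0

/-- The periodic square lattice as a graph on the checks; distances between checks are graph
distances in it. -/
def toricGraph (L : ℕ) : SimpleGraph (ToricCheck L) where
  Adj c c' := c ≠ c' ∧ ∃ q, c ∈ toricEnds L q ∧ c' ∈ toricEnds L q
  symm := ⟨fun _ _ h => ⟨h.1.symm, h.2.imp fun _ hq => ⟨hq.2, hq.1⟩⟩⟩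
  loopless := ⟨fun _ h => h.1 rfl⟩

end MinSum

end

namespace MinSum

/-! ### Directed messages on the torus -/

/-! In units of `γ` every message is an integer. A sign-min product keeps the common parity of its
inputs and adding the prior flips it, so at each iteration all messages have the same parity. An a
posteriori value is the sum of the two messages crossing an edge minus the doubly counted prior,
hence an odd multiple of `γ`: ties never occur.

If `c` is the only unsatisfied check, point reflection about `c` preserves the syndrome and
exchanges opposite edges at `c`, which therefore have equal nonzero values. Their estimated bits
agree in pairs, the parity at `c` is even, and `c` stays violated.

It remains to prove blindness. Around an unsatisfied check the messages are governed by four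
integers (`Profile`) obeying an autonomous recursion (`Profile.next`). Distant messages need not be
known, only bounded below by `far`: wherever they meet a message near the check, the minimum is
attained by the latter. This closes up as long as `0 ≤ back` and `|fwd| ≤ far`, and the recursion is
eventually periodic, so finitely many cases settle these inequalities. The profile depends on the
iteration alone, hence is the same for `s` and for the single-check syndrome. -/

/-- The four lattice directions east, north, west, south, as integer vectors. -/
def dirOffset : Fin 4 → ℤ × ℤ := ![(1, 0), (0, 1), (-1, 0), (0, -1)]

/-- An integer vector reduced to a translation of the torus. -/
def torusVec (L : ℕ) (z : ℤ × ℤ) : ToricCheck L := ((z.1 : ZMod L), (z.2 : ZMod L))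

/-- The translation of the torus by one step in a given direction. -/
def dirVec (L : ℕ) (d : Fin 4) : ToricCheck L := torusVec L (dirOffset d)

/-- The edge that leaves the vertex `v` in direction `d`. -/
def dirEdge (L : ℕ) (v : ToricCheck L) : Fin 4 → ToricQubit L :=
  ![Sum.inl v, Sum.inr v, Sum.inl (v - (1, 0)), Sum.inr (v - (0, 1))]

/-- The sign-min combination of three incoming messages. -/
def tri (a b c : ℤ) : ℤ := a.sign * b.sign * c.sign * min |a| (min |b| |c|)

/-- The message received by `v` from direction `k`, when `x w d` is the message sent by `w` in
direction `d`. -/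
def incoming {L : ℕ} (x : ToricCheck L → Fin 4 → ℤ) (v : ToricCheck L) (k : Fin 4) : ℤ :=
  x (v + dirVec L k) (k + 2)

/-- One flooding iteration, in units of the a priori value. -/
def flood {L : ℕ} (s : ToricCheck L → ZMod 2) (x : ToricCheck L → Fin 4 → ℤ)
    (v : ToricCheck L) (d : Fin 4) : ℤ :=
  1 + (if s v = 1 then -1 else 1) *
    tri (incoming x v (d + 1)) (incoming x v (d + 2)) (incoming x v (d + 3))

/-- The qubit-to-check messages, in units of the a priori value: `dirMsg s i v d` is the message
that passes through the edge leaving `v` in direction `d`, towards the far end of that edge. -/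
def dirMsg {L : ℕ} (s : ToricCheck L → ZMod 2) : ℕ → ToricCheck L → Fin 4 → ℤ
  | 0 => fun _ _ => 1
  | i + 1 => flood s (dirMsg s i)

/-! ### The sign-min combination -/

theorem tri_swap_left (a b c : ℤ) : tri a b c = tri b a c := by
  simp only [tri, mul_comm a.sign, min_left_comm]

theorem tri_swap_right (a b c : ℤ) : tri a b c = tri a c b := by
  simp only [tri, mul_right_comm _ b.sign, min_comm |b|]

theorem tri_rotate (a b c : ℤ) : tri a b c = tri c a b := by
  rw [tri_swap_right, tri_swap_left]

theorem abs_tri (a b c : ℤ) : |tri a b c| = min |a| (min |b| |c|) := by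
  rcases eq_or_ne a 0 with rfl | ha
  · simp [tri]
  rcases eq_or_ne b 0 with rfl | hb
  · simp [tri]
  rcases eq_or_ne c 0 with rfl | hc
  · simp [tri]
  simp [tri, abs_mul, Int.abs_sign_of_ne_zero, ha, hb, hc]

theorem tri_nonneg {a b c : ℤ} (ha : 0 ≤ a) (hb : 0 ≤ b) (hc : 0 ≤ c) : 0 ≤ tri a b c :=
  mul_nonneg (mul_nonneg (mul_nonneg (Int.sign_nonneg_iff.2 ha) (Int.sign_nonneg_iff.2 hb))
    (Int.sign_nonneg_iff.2 hc)) (by positivity)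

theorem tri_of_nonneg {a b c : ℤ} (ha : 0 ≤ a) (hb : 0 ≤ b) (hc : 0 ≤ c) :
    tri a b c = min a (min b c) := by
  have h := abs_tri a b c
  rwa [abs_of_nonneg (tri_nonneg ha hb hc), abs_of_nonneg ha, abs_of_nonneg hb,
    abs_of_nonneg hc] at h

theorem tri_neg_left (a b c : ℤ) : tri (-a) b c = -tri a b c := by
  simp [tri]

theorem tri_of_le {o b e : ℤ} (hb : 0 ≤ b) (he : b ≤ e) : tri o b e = tri o b b := by
  rcases le_total 0 o with ho | ho
  · rw [tri_of_nonneg ho hb (hb.trans he), tri_of_nonneg ho hb hb]; omega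
  · obtain ⟨p, rfl⟩ : ∃ p, o = -p := ⟨-o, by simp⟩
    have hp : 0 ≤ p := by omega
    rw [tri_neg_left, tri_neg_left, tri_of_nonneg hp hb (hb.trans he), tri_of_nonneg hp hb hb]
    omega

theorem tri_eq_left {a b c : ℤ} (hb : |a| ≤ b) (hc : |a| ≤ c) : tri a b c = a := by
  have h0 := abs_nonneg a
  rcases le_total 0 a with ha | ha
  · rw [abs_of_nonneg ha] at hb hc
    rw [tri_of_nonneg ha (by omega) (by omega)]; omega
  · obtain ⟨p, rfl⟩ : ∃ p, a = -p := ⟨-a, by simp⟩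
    have hp : 0 ≤ p := by omega
    rw [abs_neg, abs_of_nonneg hp] at hb hc
    rw [tri_neg_left, tri_of_nonneg hp (by omega) (by omega)]
    omega

/-- If some input equals `B`, the absolute value of the result is at most `|B|`; otherwise all
inputs are nonnegative. This gives the lower bound on distant messages, with `B = fwd` and `b =
far`. -/
theorem le_tri {B b a₁ a₂ a₃ : ℤ} (hB : |B| ≤ b) (h₁ : a₁ = B ∨ b ≤ a₁) (h₂ : a₂ = B ∨ b ≤ a₂)
    (h₃ : a₃ = B ∨ b ≤ a₃) : B ≤ tri a₁ a₂ a₃ := by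
  have h0 := abs_nonneg B
  rcases le_total 0 B with hB0 | hB0
  · rw [abs_of_nonneg hB0] at hB
    rw [tri_of_nonneg (by omega) (by omega) (by omega)]; omega
  · have key := abs_tri a₁ a₂ a₃
    have hle := neg_abs_le (tri a₁ a₂ a₃)
    by_cases h : b ≤ a₁ ∧ b ≤ a₂ ∧ b ≤ a₃
    · exact hB0.trans (tri_nonneg (by omega) (by omega) (by omega))
    · have hmin : min |a₁| (min |a₂| |a₃|) ≤ |B| := by
        rcases h₁ with rfl | h₁
        · exact min_le_left _ _
        rcases h₂ with rfl | h₂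
        · exact (min_le_right _ _).trans (min_le_left _ _)
        rcases h₃ with rfl | h₃
        · exact (min_le_right _ _).trans (min_le_right _ _)
        exact absurd ⟨h₁, h₂, h₃⟩ h
      rw [abs_of_nonpos hB0] at hmin
      omega

/-- Up to sign the result is one of the inputs, and signs do not affect parity. -/
theorem tri_emod_two {a b c n : ℤ} (ha : a % 2 = n) (hb : b % 2 = n) (hc : c % 2 = n) :
    tri a b c % 2 = n := by
  have h := abs_tri a b c
  rcases abs_choice (tri a b c) with h₀ | h₀ <;> rcases abs_choice a with h₁ | h₁ <;>
    rcases abs_choice b with h₂ | h₂ <;> rcases abs_choice c with h₃ | h₃ <;>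
    rw [h₀, h₁, h₂, h₃] at h <;> omega

/-- At iteration `i` all messages have the parity of `i + 1`. -/
theorem dirMsg_emod_two {L : ℕ} (s : ToricCheck L → ZMod 2) (i : ℕ) (v : ToricCheck L)
    (d : Fin 4) : dirMsg s i v d % 2 = ((i : ℤ) + 1) % 2 := by
  induction i generalizing v d with
  | zero => simp [dirMsg]
  | succ i ih =>
    have h : tri (incoming (dirMsg s i) v (d + 1)) (incoming (dirMsg s i) v (d + 2))
        (incoming (dirMsg s i) v (d + 3)) % 2 = ((i : ℤ) + 1) % 2 :=
      tri_emod_two (ih _ _) (ih _ _) (ih _ _)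
    simp only [dirMsg, flood]
    push_cast
    split_ifs <;> omega

/-! ### Geometry of the torus -/

theorem torusVec_add (L : ℕ) (z w : ℤ × ℤ) :
    torusVec L (z + w) = torusVec L z + torusVec L w := by
  simp [torusVec]

theorem torusVec_sub (L : ℕ) (z w : ℤ × ℤ) :
    torusVec L (z - w) = torusVec L z - torusVec L w := by
  simp [torusVec]

theorem dirVec_add_two (L : ℕ) (d : Fin 4) : dirVec L (d + 2) = -dirVec L d := by
  fin_cases d <;> simp [dirVec, dirOffset, torusVec]

theorem add_two_add_two (d : Fin 4) : d + 2 + 2 = d := by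
  revert d; decide

theorem torusVec_injOn {L : ℕ} {z w : ℤ × ℤ} (h : torusVec L z = torusVec L w)
    (h₁ : |z.1 - w.1| < L) (h₂ : |z.2 - w.2| < L) : z = w := by
  have key : ∀ a b : ℤ, (a : ZMod L) = b → |a - b| < L → a = b := by
    intro a b hab hlt
    have hd : (L : ℤ) ∣ a - b := by
      rw [← ZMod.intCast_eq_intCast_iff_dvd_sub]; exact hab.symm
    have := Int.eq_zero_of_abs_lt_dvd hd hlt
    omega
  exact Prod.ext (key _ _ (congrArg Prod.fst h) h₁) (key _ _ (congrArg Prod.snd h) h₂)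

theorem dirVec_ne_zero {L : ℕ} (hL : 2 ≤ L) (d : Fin 4) : dirVec L d ≠ 0 := by
  have : Fact (1 < L) := ⟨hL⟩
  fin_cases d <;> simp [dirVec, dirOffset, torusVec, Prod.ext_iff]

theorem mem_toricEnds_dirEdge (L : ℕ) (v c : ToricCheck L) (d : Fin 4) :
    c ∈ toricEnds L (dirEdge L v d) ↔ c = v ∨ c = v + dirVec L d := by
  have h₀ : v + (0, 0) = v := add_zero v
  fin_cases d <;>
    simp [dirEdge, toricEnds, dirVec, dirOffset, torusVec, sub_eq_add_neg, add_assoc, h₀, or_comm]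

theorem toricGraph_adj_dirVec {L : ℕ} (hL : 2 ≤ L) (v : ToricCheck L) (d : Fin 4) :
    (toricGraph L).Adj v (v + dirVec L d) :=
  ⟨by simpa using dirVec_ne_zero hL d, dirEdge L v d, by simp [mem_toricEnds_dirEdge],
    by simp [mem_toricEnds_dirEdge]⟩

theorem exists_walk_nsmul_dirVec {L : ℕ} (hL : 2 ≤ L) (v : ToricCheck L) (d : Fin 4) (n : ℕ) :
    ∃ p : (toricGraph L).Walk v (v + n • dirVec L d), p.length = n := by
  induction n with
  | zero => exact ⟨SimpleGraph.Walk.nil.copy rfl (by simp), by simp⟩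
  | succ n ih =>
    obtain ⟨p, hp⟩ := ih
    exact ⟨(p.concat (toricGraph_adj_dirVec hL _ d)).copy rfl (by rw [succ_nsmul, add_assoc]),
      by simp [hp]⟩

theorem dist_add_torusVec_le {L : ℕ} (hL : 2 ≤ L) (v : ToricCheck L) (z : ℤ × ℤ) :
    ((toricGraph L).dist v (v + torusVec L z) : ℤ) ≤ |z.1| + |z.2| := by
  have hor : ∃ d, z.1.natAbs • dirVec L d = torusVec L (z.1, 0) := by
    rcases Int.natAbs_eq z.1 with h | h
    · exact ⟨0, by rw [h]; simp [dirVec, dirOffset, torusVec]⟩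
    · exact ⟨2, by rw [h]; simp [dirVec, dirOffset, torusVec]⟩
  have ver : ∃ d, z.2.natAbs • dirVec L d = torusVec L (0, z.2) := by
    rcases Int.natAbs_eq z.2 with h | h
    · exact ⟨1, by rw [h]; simp [dirVec, dirOffset, torusVec]⟩
    · exact ⟨3, by rw [h]; simp [dirVec, dirOffset, torusVec]⟩
  obtain ⟨d, hd⟩ := hor
  obtain ⟨d', hd'⟩ := ver
  obtain ⟨p, hp⟩ := exists_walk_nsmul_dirVec hL v d z.1.natAbs
  obtain ⟨q, hq⟩ := exists_walk_nsmul_dirVec hL (v + z.1.natAbs • dirVec L d) d' z.2.natAbs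
  have hend : v + z.1.natAbs • dirVec L d + z.2.natAbs • dirVec L d' = v + torusVec L z := by
    rw [hd, hd', add_assoc, ← torusVec_add]; simp
  have := SimpleGraph.dist_le (p.append q)
  rw [SimpleGraph.Walk.length_append, hp, hq, hend] at this
  rw [Int.abs_eq_natAbs, Int.abs_eq_natAbs]
  exact_mod_cast this

/-- Coordinates can be reduced to absolute value at most `L / 2`, so the diameter of the torus is at
most `L`. -/
theorem five_le_of_dist {L : ℕ} [NeZero L] (hL : 2 ≤ L) {c c' : ToricCheck L}
    (h : 5 ≤ (toricGraph L).dist c c') : 5 ≤ L := by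
  have hz : c + torusVec L ((c' - c).1.valMinAbs, (c' - c).2.valMinAbs) = c' := by
    ext <;> simp [torusVec]
  have := dist_add_torusVec_le hL c ((c' - c).1.valMinAbs, (c' - c).2.valMinAbs)
  rw [hz] at this
  have h₁ := ZMod.natAbs_valMinAbs_le (c' - c).1
  have h₂ := ZMod.natAbs_valMinAbs_le (c' - c).2
  simp only [Int.abs_eq_natAbs] at this
  omega

/-! ### Min-sum messages as directed messages -/

theorem mem_checkNbrs_iff {L : ℕ} [NeZero L] (v : ToricCheck L) (q : ToricQubit L) :
    q ∈ checkNbrs (toricH L) v ↔ v ∈ toricEnds L q := by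
  simp [checkNbrs, toricH]

theorem checkNbrs_toricH {L : ℕ} [NeZero L] (v : ToricCheck L) :
    checkNbrs (toricH L) v = univ.image (dirEdge L v) := by
  ext q
  rw [mem_checkNbrs_iff, mem_image]
  constructor
  · rcases q with w | w <;> intro h <;>
      simp only [toricEnds, mem_insert, mem_singleton] at h <;> rcases h with rfl | rfl
    · exact ⟨0, mem_univ _, rfl⟩
    · exact ⟨2, mem_univ _, by simp [dirEdge]⟩
    · exact ⟨1, mem_univ _, rfl⟩
    · exact ⟨3, mem_univ _, by simp [dirEdge]⟩
  · rintro ⟨d, -, rfl⟩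
    simp [mem_toricEnds_dirEdge]

theorem qubitNbrs_toricH {L : ℕ} [NeZero L] (v : ToricCheck L) (d : Fin 4) :
    qubitNbrs (toricH L) (dirEdge L v d) = {v, v + dirVec L d} := by
  ext c
  simp [qubitNbrs, toricH, mem_toricEnds_dirEdge, or_iff_not_imp_left]

/-- For `L = 2` opposite neighbours of a vertex coincide, but the edges leading to them do not;
indexing messages by direction keeps them apart. -/
theorem dirEdge_injective {L : ℕ} (hL : 2 ≤ L) (v : ToricCheck L) :
    Function.Injective (dirEdge L v) := by
  have : Fact (1 < L) := ⟨hL⟩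
  intro d d' h
  fin_cases d <;> fin_cases d' <;> simp [dirEdge, Prod.ext_iff, eq_sub_iff_add_eq] at h ⊢

theorem dirEdge_add_dirVec (L : ℕ) (v : ToricCheck L) (d : Fin 4) :
    dirEdge L (v + dirVec L d) (d + 2) = dirEdge L v d := by
  have h₀ : v + (0, 0) = v := add_zero v
  fin_cases d <;> simp [dirEdge, dirVec, dirOffset, torusVec, sub_eq_add_neg, add_assoc, h₀]

theorem checkNbrs_erase_dirEdge {L : ℕ} [NeZero L] (hL : 2 ≤ L) (v : ToricCheck L) (d : Fin 4) :
    (checkNbrs (toricH L) v).erase (dirEdge L v d) =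
      image (dirEdge L v) {d + 1, d + 2, d + 3} := by
  rw [checkNbrs_toricH, ← image_erase (dirEdge_injective hL v)]
  congr 1
  revert d; decide

theorem sign_mul_intCast {γ : ℝ} (hγ : 0 < γ) (a : ℤ) : Real.sign (γ * a) = (a.sign : ℝ) := by
  rcases lt_trichotomy a 0 with h | rfl | h
  · have h' : (a : ℝ) < 0 := by exact_mod_cast h
    rw [Real.sign_of_neg (mul_neg_of_pos_of_neg hγ h'), Int.sign_eq_neg_one_of_neg h]; simp
  · simp
  · have h' : (0 : ℝ) < a := by exact_mod_cast h
    rw [Real.sign_of_pos (mul_pos hγ h'), Int.sign_eq_one_of_pos h]; simp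

/-- The sign-min rule is positively homogeneous, so `γ` factors out. The `- 1` removes the prior
that `flood` includes. -/
theorem checkMsg_toricH {L : ℕ} [NeZero L] (hL : 2 ≤ L) {γ : ℝ} (hγ : 0 < γ)
    (s : ToricCheck L → ZMod 2) (m : ToricQubit L → ToricCheck L → ℝ)
    (x : ToricCheck L → Fin 4 → ℤ) (v : ToricCheck L)
    (hm : ∀ k, m (dirEdge L v k) v = γ * incoming x v k) (d : Fin 4) :
    checkMsg (toricH L) s m v (dirEdge L v d) = γ * (flood s x v d - 1 : ℤ) := by
  have hinj := dirEdge_injective hL v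
  have h₁ : d + 1 ∉ ({d + 2, d + 3} : Finset (Fin 4)) := by revert d; decide
  have h₂ : d + 2 ∉ ({d + 3} : Finset (Fin 4)) := by revert d; decide
  have hne : (image (dirEdge L v) {d + 1, d + 2, d + 3}).Nonempty := by simp
  have hmin : minOver (image (dirEdge L v) {d + 1, d + 2, d + 3}) (fun q => |m q v|) =
      γ * (min |incoming x v (d + 1)| (min |incoming x v (d + 2)| |incoming x v (d + 3)|) : ℤ) := by
    rw [minOver, dif_pos hne, inf'_image, inf'_insert (by simp), inf'_insert (by simp),
      inf'_singleton]
    simp only [Function.comp, hm, abs_mul, abs_of_pos hγ]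
    push_cast
    rw [mul_min_of_nonneg _ _ hγ.le, mul_min_of_nonneg _ _ hγ.le]
  rw [checkMsg, checkNbrs_erase_dirEdge hL, hmin, prod_image hinj.injOn, prod_insert h₁,
    prod_insert h₂, prod_singleton]
  simp only [hm, sign_mul_intCast hγ, flood, tri]
  push_cast
  split_ifs <;> ring

theorem qubitMsg_toricH {L : ℕ} [NeZero L] (hL : 2 ≤ L) {γ : ℝ} (hγ : 0 < γ)
    (s : ToricCheck L → ZMod 2) (i : ℕ) (v : ToricCheck L) (k : Fin 4) :
    qubitMsg (toricH L) (fun _ => γ) s i (dirEdge L v k) v =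
      γ * incoming (dirMsg s i) v k := by
  induction i generalizing v k with
  | zero => simp [qubitMsg, dirMsg, incoming]
  | succ i ih =>
    have he : (qubitNbrs (toricH L) (dirEdge L v k)).erase v = {v + dirVec L k} := by
      rw [qubitNbrs_toricH, erase_insert (by simpa using dirVec_ne_zero hL k)]
    rw [qubitMsg, he, sum_singleton, ← dirEdge_add_dirVec,
      checkMsg_toricH hL hγ s _ (dirMsg s i) _ (fun k' => ih _ k')]
    simp only [dirMsg, incoming]
    push_cast
    ring

theorem app_toricH {L : ℕ} [NeZero L] (hL : 2 ≤ L) {γ : ℝ} (hγ : 0 < γ)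
    (s : ToricCheck L → ZMod 2) (i : ℕ) (v : ToricCheck L) (d : Fin 4) :
    app (toricH L) (fun _ => γ) s i (dirEdge L v d) =
      γ * (dirMsg s i v d + incoming (dirMsg s i) v d - 1 : ℤ) := by
  cases i with
  | zero => simp [app, dirMsg, incoming]
  | succ i =>
    have h := checkMsg_toricH hL hγ s _ (dirMsg s i) (v + dirVec L d)
      (fun k => qubitMsg_toricH hL hγ s i _ k) (d + 2)
    rw [dirEdge_add_dirVec] at h
    rw [app, qubitNbrs_toricH, sum_pair (by simpa using (dirVec_ne_zero hL d)), h,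
      checkMsg_toricH hL hγ s _ (dirMsg s i) v (fun k => qubitMsg_toricH hL hγ s i _ k)]
    simp only [dirMsg, incoming]
    push_cast
    ring

/-- The a posteriori value of a qubit is an odd multiple of the a priori value. -/
theorem app_toricH_ne_zero {L : ℕ} [NeZero L] (hL : 2 ≤ L) {γ : ℝ} (hγ : 0 < γ)
    (s : ToricCheck L → ZMod 2) (i : ℕ) (v : ToricCheck L) (d : Fin 4) :
    app (toricH L) (fun _ => γ) s i (dirEdge L v d) ≠ 0 := by
  have h₁ := dirMsg_emod_two s i v d
  have h₂ : incoming (dirMsg s i) v d % 2 = ((i : ℤ) + 1) % 2 := dirMsg_emod_two s i _ _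
  rw [app_toricH hL hγ]
  refine mul_ne_zero hγ.ne' (Int.cast_ne_zero.2 ?_)
  omega

/-! ### Point reflection -/

/-- Flooding commutes with the reflection `v ↦ c + c - v`, which turns direction `d` into the
opposite direction `d + 2`. -/
theorem dirMsg_reflect {L : ℕ} (s : ToricCheck L → ZMod 2) (c : ToricCheck L)
    (hs : ∀ v, s (c + c - v) = s v) (i : ℕ) (v : ToricCheck L) (d : Fin 4) :
    dirMsg s i (c + c - v) (d + 2) = dirMsg s i v d := by
  induction i generalizing v d with
  | zero => rfl
  | succ i ih =>
    have hin : ∀ k, incoming (dirMsg s i) (c + c - v) (k + 2) = incoming (dirMsg s i) v k := by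
      intro k
      rw [incoming, incoming, ← ih (v + dirVec L k), dirVec_add_two, ← sub_eq_add_neg,
        sub_sub]
    have e₁ : d + 2 + 1 = d + 1 + 2 := by revert d; decide
    have e₃ : d + 2 + 3 = d + 3 + 2 := by revert d; decide
    simp only [dirMsg, flood, hs, e₁, e₃, hin]

theorem single_reflect {L : ℕ} (c v : ToricCheck L) :
    (Pi.single c 1 : ToricCheck L → ZMod 2) (c + c - v) =
      (Pi.single c 1 : ToricCheck L → ZMod 2) v := by
  rw [Pi.single_apply, Pi.single_apply]
  congr 1
  rw [eq_iff_iff]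
  constructor
  · intro h; linear_combination (exp := 1) -h
  · rintro rfl; abel

theorem app_single_reflect {L : ℕ} [NeZero L] (hL : 2 ≤ L) {γ : ℝ} (hγ : 0 < γ)
    (c : ToricCheck L) (i : ℕ) (d : Fin 4) :
    app (toricH L) (fun _ => γ) (Pi.single c 1) i (dirEdge L c (d + 2)) =
      app (toricH L) (fun _ => γ) (Pi.single c 1) i (dirEdge L c d) := by
  have h := dirMsg_reflect (Pi.single c (1 : ZMod 2)) c (single_reflect c) i
  have h₁ := h c d
  have h₂ := h (c + dirVec L d) (d + 2)
  rw [add_sub_cancel_right] at h₁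
  rw [show c + c - (c + dirVec L d) = c + dirVec L (d + 2) by rw [dirVec_add_two]; abel] at h₂
  rw [app_toricH hL hγ, app_toricH hL hγ, h₁, incoming, h₂, incoming]

/-! ### The periodic regime around an isolated unsatisfied check -/

/-- The vertices at lattice distance at most one from an unsatisfied check. -/
def IsCore {L : ℕ} (s : ToricCheck L → ZMod 2) (v : ToricCheck L) : Prop :=
  ∃ (c : ToricCheck L) (z : ℤ × ℤ), s c = 1 ∧ |z.1| + |z.2| ≤ 1 ∧ v = c + torusVec L z

/-- Any two unsatisfied checks are at distance at least five. -/
def IsSparse {L : ℕ} (s : ToricCheck L → ZMod 2) : Prop :=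
  ∀ c c' : ToricCheck L, s c = 1 → s c' = 1 → c ≠ c' → 5 ≤ (toricGraph L).dist c c'

/-- A displacement of length at most 4 is too short to join two distinct unsatisfied checks, and too
short to wrap around the torus back to the same one. -/
theorem IsSparse.eq_zero {L : ℕ} (hL : 5 ≤ L) {s : ToricCheck L → ZMod 2} (h : IsSparse s)
    {c c' : ToricCheck L} (hc : s c = 1) (hc' : s c' = 1) {z : ℤ × ℤ} (hz : |z.1| + |z.2| ≤ 4)
    (e : c' = c + torusVec L z) : z = 0 := by
  have h₁ := abs_nonneg z.1
  have h₂ := abs_nonneg z.2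
  by_cases hcc : c = c'
  · refine torusVec_injOn (L := L) ?_ (by simp; omega) (by simp; omega)
    rw [← hcc, left_eq_add] at e
    rw [e]; ext <;> simp [torusVec]
  · have h₃ := h c c' hc hc' hcc
    have h₄ := dist_add_torusVec_le (by omega : 2 ≤ L) c z
    rw [← e] at h₄
    omega

theorem IsSparse.not_isCore {L : ℕ} (hL : 5 ≤ L) {s : ToricCheck L → ZMod 2} (h : IsSparse s)
    {c : ToricCheck L} (hc : s c = 1) {z : ℤ × ℤ} (hz : |z.1| + |z.2| ≤ 3)
    (hz' : 1 < |z.1| + |z.2|) : ¬ IsCore s (c + torusVec L z) := by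
  rintro ⟨c', w, hc', hw, e⟩
  have h₁ := abs_sub z.1 w.1
  have h₂ := abs_sub z.2 w.2
  have := h.eq_zero hL hc hc' (z := z - w) (by simp only [Prod.fst_sub, Prod.snd_sub]; omega)
    (by rw [torusVec_sub, ← add_sub_assoc, e, add_sub_cancel_right])
  rw [sub_eq_zero] at this
  subst this
  omega

/-- The state of the messages around the unsatisfied checks: `out` leaves such a check, `back`
enters it, `fwd` leaves one of its neighbours in the other directions, and `far` bounds from below
all the messages sent by the vertices further away. -/
structure Profile where
  out : ℤ
  back : ℤ
  fwd : ℤ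
  far : ℤ
  deriving DecidableEq

/-- The effect of one flooding iteration on a profile. -/
def Profile.next (p : Profile) : Profile where
  out := 1 - p.back
  back := 1 + p.far
  fwd := 1 + tri p.out p.far p.far
  far := 1 + p.fwd

/-- The profile after `i` iterations. -/
def profile : ℕ → Profile
  | 0 => ⟨1, 1, 1, 1⟩
  | i + 1 => (profile i).next

/-- The recursion is autonomous, so a single coincidence, between iterations 6 and 12, makes it
periodic from then on. -/
theorem profile_add_twelve (i : ℕ) : profile (i + 12) = profile (i + 6) := by
  induction i with
  | zero => decide
  | succ i ih =>
    exact congrArg Profile.next ih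

theorem profile_bounds (i : ℕ) : 0 ≤ (profile i).back ∧ |(profile i).fwd| ≤ (profile i).far := by
  induction i using Nat.strong_induction_on with
  | _ i ih =>
    rcases lt_or_ge i 12 with h | h
    · interval_cases i <;> decide
    · obtain ⟨j, rfl⟩ := Nat.exists_eq_add_of_le' h
      rw [profile_add_twelve]
      exact ih _ (by omega)

/-- The messages `x` have the profile `p` around each unsatisfied check of `s`. -/
structure HasProfile {L : ℕ} (s : ToricCheck L → ZMod 2) (x : ToricCheck L → Fin 4 → ℤ)
    (p : Profile) : Prop where
  out : ∀ c d, s c = 1 → x c d = p.out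
  back : ∀ c d, s c = 1 → x (c + dirVec L d) (d + 2) = p.back
  fwd : ∀ c d d', s c = 1 → d' ≠ d + 2 → x (c + dirVec L d) d' = p.fwd
  -- The lower bound `far` is attained here, on the messages entering a neighbour of `c` sideways.
  -- This is what makes `back` computable exactly.
  diag : ∀ c d d', s c = 1 → d' ≠ d → d' ≠ d + 2 →
    x (c + dirVec L d + dirVec L d') (d + 2) = p.far
  far : ∀ v d, ¬ IsCore s v → p.far ≤ x v d

theorem exists_dirOffset {z : ℤ × ℤ} (hz : |z.1| + |z.2| ≤ 1) :
    z = 0 ∨ ∃ d, z = dirOffset d := by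
  obtain ⟨a, b⟩ := z
  simp only [dirOffset, Prod.ext_iff, Fin.exists_fin_succ] at *
  have : -1 ≤ a ∧ a ≤ 1 ∧ -1 ≤ b ∧ b ≤ 1 := by
    have := abs_nonneg a; have := abs_nonneg b
    refine ⟨?_, ?_, ?_, ?_⟩ <;> have := abs_le.1 (le_refl |a|) <;>
      have := abs_le.1 (le_refl |b|) <;> omega
  obtain ⟨_, _, _, _⟩ := this
  interval_cases a <;> interval_cases b <;> simp at *

theorem isCore_of_eq_one {L : ℕ} {s : ToricCheck L → ZMod 2} {v : ToricCheck L} (h : s v = 1) :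
    IsCore s v :=
  ⟨v, 0, h, by simp, by simp [torusVec]⟩

theorem IsSparse.not_isCore_two {L : ℕ} (hL : 5 ≤ L) {s : ToricCheck L → ZMod 2}
    (h : IsSparse s) {c : ToricCheck L} (hc : s c = 1) {d d' : Fin 4} (hd : d' ≠ d + 2) :
    ¬ IsCore s (c + dirVec L d + dirVec L d') := by
  rw [add_assoc, dirVec, dirVec, ← torusVec_add]
  refine h.not_isCore hL hc ?_ ?_ <;> revert hd <;> decide +revert

theorem IsSparse.not_isCore_three {L : ℕ} (hL : 5 ≤ L) {s : ToricCheck L → ZMod 2}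
    (h : IsSparse s) {c : ToricCheck L} (hc : s c = 1) {d d' : Fin 4} (hd : d' ≠ d + 2) :
    ¬ IsCore s (c + dirVec L d + dirVec L d' + dirVec L d') := by
  rw [add_assoc, add_assoc, dirVec, dirVec, ← torusVec_add, ← torusVec_add]
  refine h.not_isCore hL hc ?_ ?_ <;> revert hd <;> decide +revert

theorem IsSparse.ne_one_of_adj {L : ℕ} (hL : 5 ≤ L) {s : ToricCheck L → ZMod 2}
    (h : IsSparse s) {c : ToricCheck L} (hc : s c = 1) (d : Fin 4) :
    s (c + dirVec L d) ≠ 1 := by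
  intro h'
  have := h.eq_zero hL hc h' (z := dirOffset d)
    ((by decide : ∀ d, |(dirOffset d).1| + |(dirOffset d).2| ≤ 4) d) rfl
  exact (by decide : ∀ d, dirOffset d ≠ 0) d this

/-! ### Stability of the profile under one flooding iteration -/

namespace HasProfile

variable {L : ℕ} {s : ToricCheck L → ZMod 2} {x : ToricCheck L → Fin 4 → ℤ} {p : Profile}

theorem incoming_not_isCore (hx : HasProfile s x p) {v : ToricCheck L} (hv : ¬ IsCore s v)
    (k : Fin 4) : incoming x v k = p.fwd ∨ p.far ≤ incoming x v k := by
  by_cases hk : IsCore s (v + dirVec L k)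
  · left
    obtain ⟨c, z, hc, hz, e⟩ := hk
    have hv' : v = c + torusVec L z + dirVec L (k + 2) := by
      rw [← e, dirVec_add_two, add_neg_cancel_right]
    rcases exists_dirOffset hz with rfl | ⟨d, rfl⟩
    · refine absurd ⟨c, dirOffset (k + 2), hc,
        (by decide : ∀ d, |(dirOffset d).1| + |(dirOffset d).2| ≤ 1) _, ?_⟩ hv
      simpa [dirVec, show torusVec L 0 = 0 by ext <;> simp [torusVec]] using hv'
    · rw [incoming, e]
      refine hx.fwd c d _ hc fun hd => hv ?_
      rw [hv', hd, dirVec_add_two, dirVec, add_neg_cancel_right]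
      exact isCore_of_eq_one hc
  · exact Or.inr (hx.far _ _ hk)

/-- The vertices whose messages must be bounded lie within distance 3 of `c`; cores have radius 1,
so separation 5 keeps those at distance 2 or 3 outside every core. -/
theorem flood (hL : 5 ≤ L) (hs : IsSparse s) (hx : HasProfile s x p) (hback : 0 ≤ p.back)
    (hfwd : |p.fwd| ≤ p.far) : HasProfile s (flood s x) p.next := by
  have hfar : 0 ≤ p.far := (abs_nonneg _).trans hfwd
  have in_fwd : ∀ c d, s c = 1 → incoming x (c + dirVec L d) (d + 2) = p.out := by
    intro c d hc
    rw [incoming, dirVec_add_two, add_neg_cancel_right]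
    exact hx.out _ _ hc
  have in_side : ∀ c d k, s c = 1 → k ≠ d → k ≠ d + 2 →
      incoming x (c + dirVec L d) k = p.far := by
    intro c d k hc h₁ h₂
    rw [incoming, add_right_comm]
    exact hx.diag c k d hc h₁.symm (by rintro rfl; exact h₂ (add_two_add_two k).symm)
  have in_front : ∀ c d, s c = 1 → p.far ≤ incoming x (c + dirVec L d) d := by
    intro c d hc
    exact hx.far _ _ (hs.not_isCore_two hL hc (by decide +revert))
  have in_diag : ∀ c d d', s c = 1 → d' ≠ d → d' ≠ d + 2 →
      incoming x (c + dirVec L d + dirVec L d') (d' + 2) = p.fwd := by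
    intro c d d' hc h₁ h₂
    rw [incoming, dirVec_add_two, add_neg_cancel_right, add_two_add_two]
    exact hx.fwd _ _ _ hc h₂
  constructor
  · intro c d hc
    have h : ∀ k, incoming x c k = p.back := fun k => hx.back _ _ hc
    simp only [MinSum.flood, h, hc, if_true, Profile.next]
    -- All inputs are nonnegative, so the only sign is that of the syndrome.
    rw [tri_of_nonneg hback hback hback]
    simp; ring
  · intro c d hc
    have e₁ : d + 2 + 1 = d + 3 := (by decide : ∀ d : Fin 4, d + 2 + 1 = d + 3) d
    have e₃ : d + 2 + 3 = d + 1 := (by decide : ∀ d : Fin 4, d + 2 + 3 = d + 1) d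
    rw [MinSum.flood, if_neg (hs.ne_one_of_adj hL hc d), add_two_add_two, e₁, e₃,
      in_side c d (d + 3) hc (by simp) (by simp),
      in_side c d (d + 1) hc (by simp) (by simp),
      tri_of_nonneg hfar (hfar.trans (in_front c d hc)) hfar, Profile.next]
    have := in_front c d hc
    simp [this]
  · intro c d d' hc hd
    have hf := in_front c d hc
    have s₁ := in_side c d (d + 1) hc (by simp) (by simp)
    have s₃ := in_side c d (d + 3) hc (by simp) (by simp)
    have s₂ := in_fwd c d hc
    rw [MinSum.flood, if_neg (hs.ne_one_of_adj hL hc d), one_mul, Profile.next]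
    have hd' : d' = d ∨ d' = d + 1 ∨ d' = d + 3 :=
      (by decide : ∀ d d' : Fin 4, d' ≠ d + 2 → d' = d ∨ d' = d + 1 ∨ d' = d + 3) d d' hd
    congr 1
    -- At least one sideways input equals `far` exactly, so the input from the front, known only to
    -- be at least `far`, can be replaced by `far`.
    rcases hd' with rfl | rfl | rfl
    · rw [s₁, s₂, s₃, tri_swap_left]
    · have e₁ : d + 1 + 1 = d + 2 := (by decide : ∀ d : Fin 4, d + 1 + 1 = d + 2) d
      have e₂ : d + 1 + 2 = d + 3 := (by decide : ∀ d : Fin 4, d + 1 + 2 = d + 3) d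
      have e₃ : d + 1 + 3 = d := (by decide : ∀ d : Fin 4, d + 1 + 3 = d) d
      rw [e₁, e₂, e₃, s₂, s₃, tri_of_le hfar hf]
    · have e₁ : d + 3 + 1 = d := (by decide : ∀ d : Fin 4, d + 3 + 1 = d) d
      have e₂ : d + 3 + 2 = d + 1 := (by decide : ∀ d : Fin 4, d + 3 + 2 = d + 1) d
      have e₃ : d + 3 + 3 = d + 2 := (by decide : ∀ d : Fin 4, d + 3 + 3 = d + 2) d
      rw [e₁, e₂, e₃, s₂, s₁, tri_rotate, tri_swap_right, tri_of_le hfar hf]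
  · intro c d d' hc h₁ h₂
    have hv := hs.not_isCore_two hL hc h₂
    have e₁ : d + 2 + 1 = d + 3 := (by decide : ∀ d : Fin 4, d + 2 + 1 = d + 3) d
    have e₃ : d + 2 + 3 = d + 1 := (by decide : ∀ d : Fin 4, d + 2 + 3 = d + 1) d
    have hd := in_diag c d d' hc h₁ h₂
    have f₁ : p.far ≤ incoming x (c + dirVec L d + dirVec L d') d' :=
      hx.far _ _ (hs.not_isCore_three hL hc h₂)
    have f₂ : p.far ≤ incoming x (c + dirVec L d + dirVec L d') d := by
      rw [incoming, add_right_comm c]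
      exact hx.far _ _ (hs.not_isCore_three hL hc
        (by rintro rfl; exact h₂ (add_two_add_two d').symm))
    rw [MinSum.flood, if_neg (fun h => hv (isCore_of_eq_one h)), add_two_add_two, e₁, e₃, one_mul,
      Profile.next]
    congr 1
    have hd' : d' = d + 1 ∨ d' = d + 3 :=
      (by decide : ∀ d d' : Fin 4, d' ≠ d → d' ≠ d + 2 → d' = d + 1 ∨ d' = d + 3) d d' h₁ h₂
    -- The input from the neighbour `c + dirVec L d` is `fwd`; the other two are at least `far ≥
    -- |fwd|`, so it passes unchanged.
    rcases hd' with rfl | rfl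
    · have e : d + 1 + 2 = d + 3 := (by decide : ∀ d : Fin 4, d + 1 + 2 = d + 3) d
      rw [e] at hd
      rw [hd, tri_eq_left (hfwd.trans f₂) (hfwd.trans f₁)]
    · have e : d + 3 + 2 = d + 1 := (by decide : ∀ d : Fin 4, d + 3 + 2 = d + 1) d
      rw [e] at hd
      rw [hd, tri_rotate, tri_eq_left (hfwd.trans f₁) (hfwd.trans f₂)]
  · intro v d hv
    have := le_tri hfwd (hx.incoming_not_isCore hv (d + 1)) (hx.incoming_not_isCore hv (d + 2))
      (hx.incoming_not_isCore hv (d + 3))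
    rw [MinSum.flood, if_neg (fun h => hv (isCore_of_eq_one h)), one_mul, Profile.next]
    simpa using this

end HasProfile

theorem hasProfile_dirMsg {L : ℕ} (hL : 5 ≤ L) {s : ToricCheck L → ZMod 2} (hs : IsSparse s)
    (i : ℕ) : HasProfile s (dirMsg s i) (profile i) := by
  induction i with
  | zero => constructor <;> intros <;> simp [dirMsg, profile]
  | succ i ih => exact ih.flood hL hs (profile_bounds i).1 (profile_bounds i).2

/-! ### Local blindness and parity violation -/

theorem isSparse_single {L : ℕ} (c : ToricCheck L) :
    IsSparse (Pi.single c 1 : ToricCheck L → ZMod 2) := by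
  intro a b ha hb hab
  simp only [Pi.single_apply, ite_eq_left_iff, zero_ne_one, imp_false, not_not] at ha hb
  exact absurd (ha.trans hb.symm) hab

theorem IsSparse.locallyBlind {L : ℕ} [NeZero L] (hL : 2 ≤ L) {γ : ℝ} (hγ : 0 < γ)
    {s : ToricCheck L → ZMod 2} (hs : IsSparse s) {c : ToricCheck L} (hc : s c = 1) :
    LocallyBlind (toricH L) (fun _ => γ) s c := by
  intro q hq i
  -- A second unsatisfied check forces `5 ≤ L`, which the profiles need. Without one, `s` is already
  -- the single-check syndrome and `L` may be small.
  by_cases h : ∃ c', s c' = 1 ∧ c ≠ c'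
  · obtain ⟨c', hc', hcc⟩ := h
    have hL5 := five_le_of_dist hL (hs c c' hc hc' hcc)
    have h₁ := hasProfile_dirMsg hL5 hs i
    have h₂ := hasProfile_dirMsg hL5 (isSparse_single c) i
    have hc₁ : (Pi.single c 1 : ToricCheck L → ZMod 2) c = 1 := Pi.single_eq_same c 1
    rw [checkNbrs_toricH, mem_image] at hq
    obtain ⟨d, -, rfl⟩ := hq
    rw [app_toricH hL hγ, app_toricH hL hγ, incoming, incoming, h₁.out c d hc, h₁.back c d hc,
      h₂.out c d hc₁, h₂.back c d hc₁]
  · push Not at h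
    have : s = Pi.single c 1 := by
      funext v
      by_cases hv : v = c
      · subst hv; rw [hc, Pi.single_eq_same]
      · rw [Pi.single_eq_of_ne hv]
        have hne : s v ≠ 1 := fun h' => hv (h v h').symm
        generalize s v = a at hne
        revert a; decide
    rw [this]

theorem IsEstimate.eq {Q : Type*} {a : Q → ℝ} {e : Q → ZMod 2} (he : IsEstimate a e) {q q' : Q}
    (h : a q = a q') (h₀ : a q ≠ 0) : e q = e q' := by
  rcases lt_or_gt_of_ne h₀ with hq | hq
  · rw [(he q).2 hq, (he q').2 (h ▸ hq)]
  · rw [(he q).1 hq, (he q').1 (h ▸ hq)]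

theorem toricH_mulVec {L : ℕ} [NeZero L] (hL : 2 ≤ L) (e : ToricQubit L → ZMod 2)
    (c : ToricCheck L) : (toricH L *ᵥ e) c = ∑ d, e (dirEdge L c d) := by
  have h : (toricH L *ᵥ e) c = ∑ q ∈ checkNbrs (toricH L) c, e q := by
    simp only [mulVec, dotProduct, checkNbrs, sum_filter]
    refine sum_congr rfl fun q _ => ?_
    simp only [toricH, of_apply]
    split_ifs <;> simp_all
  rw [h, checkNbrs_toricH, sum_image (dirEdge_injective hL c).injOn]

end MinSum

theorem mainTheorem2 (L : ℕ) [NeZero L] (hL : 2 ≤ L) (γ : ℝ) (hγ : 0 < γ)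
    (s : MinSum.ToricCheck L → ZMod 2) (hs : s ≠ 0)
    (hdist : ∀ c c' : MinSum.ToricCheck L, s c = 1 → s c' = 1 → c ≠ c' →
      5 ≤ (MinSum.toricGraph L).dist c c') :
    (∀ c : MinSum.ToricCheck L, s c = 1 →
      MinSum.LocallyBlind (MinSum.toricH L) (fun _ => γ) s c ∧
      ∀ i : ℕ,
        MinSum.app (MinSum.toricH L) (fun _ => γ) s i (Sum.inl c) =
          MinSum.app (MinSum.toricH L) (fun _ => γ) s i (Sum.inl (c - (1, 0))) ∧
        MinSum.app (MinSum.toricH L) (fun _ => γ) s i (Sum.inr c) =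
          MinSum.app (MinSum.toricH L) (fun _ => γ) s i (Sum.inr (c - (0, 1))) ∧
        ∀ e : MinSum.ToricQubit L → ZMod 2,
          MinSum.IsEstimate (MinSum.app (MinSum.toricH L) (fun _ => γ) s i) e →
          (MinSum.toricH L *ᵥ e) c ≠ s c) ∧
    ¬ MinSum.Decodes (MinSum.toricH L) (fun _ => γ) s := by
  open MinSum in
  have main : ∀ c : ToricCheck L, s c = 1 → LocallyBlind (toricH L) (fun _ => γ) s c ∧
      ∀ i : ℕ, app (toricH L) (fun _ => γ) s i (Sum.inl c) =
          app (toricH L) (fun _ => γ) s i (Sum.inl (c - (1, 0))) ∧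
        app (toricH L) (fun _ => γ) s i (Sum.inr c) =
          app (toricH L) (fun _ => γ) s i (Sum.inr (c - (0, 1))) ∧
        ∀ e : ToricQubit L → ZMod 2, IsEstimate (app (toricH L) (fun _ => γ) s i) e →
          (toricH L *ᵥ e) c ≠ s c := by
    intro c hc
    have hblind := IsSparse.locallyBlind hL hγ hdist hc
    have hpair : ∀ (i : ℕ) (d : Fin 4), app (toricH L) (fun _ => γ) s i (dirEdge L c d) =
        app (toricH L) (fun _ => γ) s i (dirEdge L c (d + 2)) := by
      intro i d
      have hmem : ∀ k, dirEdge L c k ∈ checkNbrs (toricH L) c := fun k => by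
        rw [checkNbrs_toricH]; exact Finset.mem_image_of_mem _ (Finset.mem_univ k)
      rw [hblind _ (hmem _), hblind _ (hmem _), app_single_reflect hL hγ]
    refine ⟨hblind, fun i => ⟨hpair i 0, hpair i 1, fun e he => ?_⟩⟩
    have h₀ : e (dirEdge L c 0) = e (dirEdge L c 2) :=
      he.eq (hpair i 0) (app_toricH_ne_zero hL hγ s i c 0)
    have h₁ : e (dirEdge L c 1) = e (dirEdge L c 3) :=
      he.eq (hpair i 1) (app_toricH_ne_zero hL hγ s i c 1)
    rw [toricH_mulVec hL, Fin.sum_univ_four, h₀, h₁, hc]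
    generalize e (dirEdge L c 2) = a
    generalize e (dirEdge L c 3) = b
    revert a b
    decide
  refine ⟨main, ?_⟩
  rintro ⟨i, e, he, heq⟩
  obtain ⟨c, hc : s c ≠ 0⟩ := Function.ne_iff.1 hs
  have hc₁ : s c = 1 := by
    generalize s c = a at hc
    revert hc; decide +revert
  exact ((main c hc₁).2 i).2.2 e he (congrFun heq c)
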